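/- Let $n\ge 2$ and let $\Lambda^*(n)$ be the exterior algebra over $\mathbb{Q}$ on degree-one generators $w_{ij}=w_{ji}$ ($1\le i\ne j\le n$), one for each unordered pair $\{i,j\}$, on which the symmetric group $S_n$ acts by algebra automorphisms with $\pi\cdot w_{ij}=w_{\pi(i)\pi(j)}$. Let $I(n)\subset\Lambda^*(n)$ be the ideal generated by the infinitesimal braid relations $$YB_{ijk}=w_{ij}w_{ik}-w_{ij}w_{jk}+w_{ik}w_{jk},\qquad 1\le i<j<k\le n,$$ which is stable under $S_n$, and let $I^2(n)=I(n)\cap\Lambda^2(n)$ be its component of degree two, viewed as a representation of $S_n$. For a partition $\lambda$ of $n$ let $V_\lambda$ be the irreducible representation of $S_n$ over $\mathbb{Q}$ corresponding to $\lambda$, that is, the Specht module spanned by the polytabloids of shape $\lambda$ (so that $V_{(n)}$ is trivial and $V_{(1,\dots,1)}$ is the sign representation), and for a partition $\mu=(\mu_1\ge\dots\ge\mu_s)$ with $n-\sum_i\mu_i\ge\mu_1$ put $V(\mu)_n=V_{(n-\sum_i\mu_i,\,\mu_1,\dots,\mu_s)}$. Then, as representations of $S_n$: 1. for every $n\ge4$,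 $\; I^2(n)\cong V(1,1)_n\oplus V(1,1,1)_n$; 2. $I^2(2)=0$; 3. $I^2(3)\cong V_{(1,1,1)}$. -/

import Mathlib

open scoped ExteriorAlgebra

noncomputable section

/-! ## The irreducible modules `V_λ` of the symmetric group, over `ℚ`

`V_λ` is the Specht module: the span of all polytabloids of shape `λ`, inside the permutation
module on tabloids. -/

namespace SymRep

/-- A (bijective) Young tableau of shape `lam` with entries in `Fin n`; it sends an entry to the
cell that contains it. There is none unless `lam` has exactly `n` cells. -/
abbrev Tableau (n : ℕ) (lam : YoungDiagram) : Type := Fin n ≃ {c : ℕ × ℕ // c ∈ lam.cells}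

/-- The row that contains the entry `a` of a tableau. -/
def Tableau.row {n : ℕ} {lam : YoungDiagram} (t : Tableau n lam) (a : Fin n) : ℕ := (t a).1.1

/-- The column that contains the entry `a` of a tableau. -/
def Tableau.col {n : ℕ} {lam : YoungDiagram} (t : Tableau n lam) (a : Fin n) : ℕ := (t a).1.2

/-- The permutation module of `Perm (Fin n)` over `ℚ` on the functions `f : Fin n → ℕ`, with
`π • f = f ∘ π⁻¹`. A tabloid (a tableau up to reordering its rows) is the same as the function
sending each entry to its row, so this contains the permutation modules on the tabloids of
all shapes. -/
def rowModule (n : ℕ) :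
    Representation ℚ (Equiv.Perm (Fin n)) ((Fin n → ℕ) →₀ ℚ) where
  toFun π := Finsupp.lmapDomain ℚ ℚ (fun f : Fin n → ℕ => f ∘ (π⁻¹ : Equiv.Perm (Fin n)))
  map_one' := by
    ext f : 2
    simp
  map_mul' π τ := by
    ext f : 2
    simp only [LinearMap.comp_apply, Finsupp.lsingle_apply, Finsupp.lmapDomain_apply,
      Finsupp.mapDomain_single, Module.End.mul_apply, mul_inv_rev, Equiv.Perm.coe_mul,
      Function.comp_assoc]

open Classical in
/-- The column group of a tableau: the permutations of the entries that keep every entry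
in its column. -/
def columnGroup {n : ℕ} {lam : YoungDiagram} (t : Tableau n lam) :
    Finset (Equiv.Perm (Fin n)) :=
  Finset.univ.filter fun σ => ∀ a, t.col (σ a) = t.col a

/-- The polytabloid `e_t = ∑_{σ} sgn(σ) σ • {t}`, the sum over the column group of `t`, where
`{t}` is the tabloid of `t`. -/
def polytabloid {n : ℕ} {lam : YoungDiagram} (t : Tableau n lam) : (Fin n → ℕ) →₀ ℚ :=
  ∑ σ ∈ columnGroup t,
    ((Equiv.Perm.sign σ : ℤ) : ℚ) • rowModule n σ (Finsupp.single t.row 1)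

theorem rowModule_polytabloid {n : ℕ} {lam : YoungDiagram} (t : Tableau n lam)
    (π : Equiv.Perm (Fin n)) :
    rowModule n π (polytabloid t) =
      polytabloid ((π⁻¹ : Equiv.Perm (Fin n)).trans t : Tableau n lam) := by
  simp only [polytabloid, map_sum, map_smul]
  refine Finset.sum_bij' (fun σ _ => π * σ * π⁻¹) (fun σ _ => π⁻¹ * σ * π) ?_ ?_ ?_ ?_ ?_
  · intro σ h
    simp only [columnGroup, Finset.mem_filter, Finset.mem_univ, true_and] at h ⊢
    intro a
    simpa [Tableau.col] using h (π⁻¹ a)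
  · intro σ h
    simp only [columnGroup, Finset.mem_filter, Finset.mem_univ, true_and] at h ⊢
    intro a
    simpa [Tableau.col] using h (π a)
  · intro σ _
    simp [mul_assoc]
  · intro σ _
    simp [mul_assoc]
  · intro σ _
    have hs : Equiv.Perm.sign (π * σ * π⁻¹) = Equiv.Perm.sign σ := by
      simp [mul_right_comm]
    rw [hs]
    congr 1
    simp only [rowModule, MonoidHom.coe_mk, OneHom.coe_mk, Finsupp.lmapDomain_apply,
      Finsupp.mapDomain_single]
    congr 1
    funext a
    simp [Tableau.row]

/-- The Specht module of shape `lam`: the subrepresentation spanned by all polytabloids. -/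
def specht (n : ℕ) (lam : YoungDiagram) : Subrepresentation (rowModule n) where
  toSubmodule := Submodule.span ℚ (Set.range fun t : Tableau n lam => polytabloid t)
  apply_mem_toSubmodule π v hv := by
    induction hv using Submodule.span_induction with
    | mem x hx =>
      obtain ⟨t, rfl⟩ := hx
      rw [rowModule_polytabloid]
      exact Submodule.subset_span ⟨_, rfl⟩
    | zero => simp
    | add x y _ _ hx hy =>
      rw [map_add]
      exact Submodule.add_mem _ hx hy
    | smul c x _ hx =>
      rw [map_smul]
      exact Submodule.smul_mem _ c hx

/-- `V_λ`, for the partition `λ` of `n` whose parts are listed in `l`. -/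
abbrev V (n : ℕ) (l : List ℕ) (hl : l.SortedGE) :
    Representation ℚ (Equiv.Perm (Fin n)) (specht n (YoungDiagram.ofRowLens l hl)).toSubmodule :=
  (specht n (YoungDiagram.ofRowLens l hl)).toRepresentation

/-- The stable notation `V(μ)_n = V_{(n - |μ|, μ_1, …, μ_s)}`, meaningful when `n - |μ| ≥ μ_1`. -/
abbrev stableV (n : ℕ) (mu : List ℕ) (h : ((n - mu.sum) :: mu).SortedGE) :=
  V n ((n - mu.sum) :: mu) h

theorem sortedGE_one_one {n : ℕ} (hn : 4 ≤ n) : ((n - [1, 1].sum) :: [1, 1]).SortedGE := by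
  rw [List.sortedGE_iff_pairwise]
  simp
  omega

theorem sortedGE_one_one_one {n : ℕ} (hn : 4 ≤ n) :
    ((n - [1, 1, 1].sum) :: [1, 1, 1]).SortedGE := by
  rw [List.sortedGE_iff_pairwise]
  simp
  omega

theorem sortedGE_three_ones : ([1, 1, 1] : List ℕ).SortedGE := by
  rw [List.sortedGE_iff_pairwise]
  simp

end SymRep

/-! ## The ideal of infinitesimal braid relations -/

namespace Arnold

/-- Index set of the generators: unordered pairs `{i, j}` with `i ≠ j` in `Fin n`. -/
abbrev Pair (n : ℕ) : Type := {p : Sym2 (Fin n) // ¬ p.IsDiag}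

/-- The exterior algebra `Λ^*(w_{ij})` over `ℚ` on one degree-one generator for each unordered
pair `{i, j}`. -/
abbrev Ext (n : ℕ) : Type := ExteriorAlgebra ℚ (Pair n →₀ ℚ)

/-- The generator `w_{ij} = w_{ji}` for `i ≠ j` (and `0` for `i = j`, a value never used). -/
def w {n : ℕ} (i j : Fin n) : Ext n :=
  if h : i = j then 0
  else ExteriorAlgebra.ι ℚ (Finsupp.single ⟨s(i, j), by simpa using h⟩ 1)

/-- The permutation action on the unordered pairs. -/
def permPair {n : ℕ} (π : Equiv.Perm (Fin n)) (p : Pair n) : Pair n :=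
  ⟨p.1.map π, by rw [Sym2.isDiag_map π.injective]; exact p.2⟩

/-- The action of the symmetric group on the exterior algebra, by the algebra automorphisms with
`π • w_{ij} = w_{π(i)π(j)}`. -/
def action (n : ℕ) : Representation ℚ (Equiv.Perm (Fin n)) (Ext n) where
  toFun π := (ExteriorAlgebra.map (Finsupp.lmapDomain ℚ ℚ (permPair π))).toLinearMap
  map_one' := by
    have h : (Finsupp.lmapDomain ℚ ℚ (permPair (1 : Equiv.Perm (Fin n)))) = LinearMap.id := by
      have : permPair (1 : Equiv.Perm (Fin n)) = id := by
        funext p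
        apply Subtype.ext
        simp [permPair]
      rw [this, Finsupp.lmapDomain_id]
    rw [h, ExteriorAlgebra.map_id]
    rfl
  map_mul' π τ := by
    have h : (Finsupp.lmapDomain ℚ ℚ (permPair (π * τ))) =
        (Finsupp.lmapDomain ℚ ℚ (permPair π)) ∘ₗ (Finsupp.lmapDomain ℚ ℚ (permPair τ)) := by
      have : permPair (π * τ) = permPair π ∘ permPair τ := by
        funext p
        apply Subtype.ext
        simp [permPair, Sym2.map_map]
      rw [this, Finsupp.lmapDomain_comp]
    rw [h, ← ExteriorAlgebra.map_comp_map]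
    rfl

/-- The infinitesimal braid (Yang-Baxter) relation
`YB_{ijk} = w_{ij} w_{ik} - w_{ij} w_{jk} + w_{ik} w_{jk}`. -/
def YB {n : ℕ} (i j k : Fin n) : Ext n := w i j * w i k - w i j * w j k + w i k * w j k

/-- The (two-sided) ideal of `Λ^*(w_{ij})` generated by the relations `YB_{ijk}`, `i < j < k`. -/
def relIdeal (n : ℕ) : TwoSidedIdeal (Ext n) :=
  TwoSidedIdeal.span {x | ∃ i j k : Fin n, i < j ∧ j < k ∧ x = YB i j k}

/-- The degree-two component `I²(n)` of the ideal of relations, as a `ℚ`-subspace. -/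
def I2 (n : ℕ) : Submodule ℚ (Ext n) :=
  (TwoSidedIdeal.asIdeal (relIdeal n)).restrictScalars ℚ ⊓ ⋀[ℚ]^2 (Pair n →₀ ℚ)

theorem action_w {n : ℕ} (π : Equiv.Perm (Fin n)) (i j : Fin n) :
    action n π (w i j) = w (π i) (π j) := by
  unfold w
  by_cases h : i = j
  · simp [h]
  · have h' : π i ≠ π j := fun e => h (π.injective e)
    simp only [h, h', dite_false]
    simp [action, permPair]

theorem action_mul {n : ℕ} (π : Equiv.Perm (Fin n)) (x y : Ext n) :
    action n π (x * y) = action n π x * action n π y := by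
  simp [action]

theorem action_YB {n : ℕ} (π : Equiv.Perm (Fin n)) (i j k : Fin n) :
    action n π (YB i j k) = YB (π i) (π j) (π k) := by
  simp only [YB, map_add, map_sub, action_mul, action_w]

theorem w_comm {n : ℕ} (i j : Fin n) : w i j = w j i := by
  unfold w
  by_cases h : i = j
  · simp [h]
  · simp only [h, Ne.symm h, dite_false, Sym2.eq_swap]

theorem w_mul_w {n : ℕ} (i j k l : Fin n) : w i j * w k l = -(w k l * w i j) := by
  unfold w
  split_ifs
  · simp
  · simp
  · simp
  · exact eq_neg_of_add_eq_zero_left (ExteriorAlgebra.ι_add_mul_swap _ _)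

theorem YB_swap_left {n : ℕ} (i j k : Fin n) : YB j i k = -YB i j k := by
  simp only [YB]
  rw [w_comm j i, w_mul_w j k i k]
  abel

theorem YB_swap_right {n : ℕ} (i j k : Fin n) : YB i k j = -YB i j k := by
  simp only [YB]
  rw [w_comm k j, w_mul_w i k i j]
  abel

theorem YB_mem {n : ℕ} {i j k : Fin n} (hij : i ≠ j) (hik : i ≠ k) (hjk : j ≠ k) :
    YB i j k ∈ relIdeal n := by
  have key : ∀ a b c : Fin n, a < b → b < c → YB a b c ∈ relIdeal n :=
    fun a b c h1 h2 => TwoSidedIdeal.subset_span ⟨a, b, c, h1, h2, rfl⟩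
  rcases lt_or_gt_of_ne hij with h1 | h1 <;> rcases lt_or_gt_of_ne hik with h2 | h2 <;>
    rcases lt_or_gt_of_ne hjk with h3 | h3
  · exact key _ _ _ h1 h3
  · rw [YB_swap_right i k j]
    exact (relIdeal n).neg_mem (key _ _ _ h2 h3)
  · exact absurd (h1.trans h3) (lt_asymm h2)
  · rw [YB_swap_right i k j, YB_swap_left k i j, neg_neg]
    exact key _ _ _ h2 h1
  · rw [YB_swap_left j i k]
    exact (relIdeal n).neg_mem (key _ _ _ h1 h2)
  · exact absurd (h3.trans h1) (lt_asymm h2)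
  · rw [YB_swap_left j i k, YB_swap_right j k i, neg_neg]
    exact key _ _ _ h3 h2
  · rw [YB_swap_left j i k, YB_swap_right j k i, YB_swap_left k j i, neg_neg]
    exact (relIdeal n).neg_mem (key _ _ _ h3 h1)

theorem action_mem_relIdeal {n : ℕ} (π : Equiv.Perm (Fin n)) {x : Ext n}
    (hx : x ∈ relIdeal n) : action n π x ∈ relIdeal n := by
  have hle : relIdeal n ≤ TwoSidedIdeal.comap
      (ExteriorAlgebra.map (Finsupp.lmapDomain ℚ ℚ (permPair π))) (relIdeal n) := by
    refine TwoSidedIdeal.span_le.2 ?_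
    rintro _ ⟨i, j, k, hij, hjk, rfl⟩
    refine (TwoSidedIdeal.mem_comap _).2 ?_
    have h := action_YB π i j k
    have hm : YB (π i) (π j) (π k) ∈ relIdeal n :=
      YB_mem (fun e => hij.ne (π.injective e)) (fun e => (hij.trans hjk).ne (π.injective e))
        (fun e => hjk.ne (π.injective e))
    rw [← h] at hm
    exact hm
  exact (TwoSidedIdeal.mem_comap
    (ExteriorAlgebra.map (Finsupp.lmapDomain ℚ ℚ (permPair π)))).1 (hle hx)

/-- `I²(n)` as a representation of the symmetric group: it is stable under the action
on the exterior algebra. -/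
def I2Sub (n : ℕ) : Subrepresentation (action n) where
  toSubmodule := I2 n
  apply_mem_toSubmodule π x hx := by
    refine ⟨action_mem_relIdeal π hx.1, ?_⟩
    have hle : (⋀[ℚ]^2 (Pair n →₀ ℚ)).map (action n π) ≤ ⋀[ℚ]^2 (Pair n →₀ ℚ) := by
      rw [ExteriorAlgebra.exteriorPower, action]
      simp only [MonoidHom.coe_mk, OneHom.coe_mk]
      rw [Submodule.map_pow]
      refine pow_le_pow_left' ?_ 2
      rw [← LinearMap.range_comp, ExteriorAlgebra.map_comp_ι]
      exact LinearMap.range_comp_le_range _ _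
    exact hle (Submodule.mem_map_of_mem hx.2)

/-- The action of the symmetric group on `I²(n)`. -/
abbrev I2Rep (n : ℕ) : Representation ℚ (Equiv.Perm (Fin n)) (I2Sub n).toSubmodule :=
  (I2Sub n).toRepresentation

end Arnold

end

/-! The relations `YB i j k` alternate in their indices, and for distinct indices each monomial `w i
j * w i k` occurs in only one of them up to reordering. So the relations are linearly independent
over unordered triples. In degree two the ideal is just their span, since elements of positive
degree only push a relation into higher degree. Hence I²(n) ≅ Λ³(ℚⁿ), which splits as Λ²(std) ⊕
Λ³(std), where std = V(1)_n.

The splitting is realised by the Koszul complex of ℚⁿ. Antisymmetrised hook tabloids with k entries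
below row 0 play the role of e_{u₁} ∧ … ∧ e_{u_k}, and a hook polytabloid is the simplicial boundary
∂ of its first column. Thus the hook Specht modules are images of ∂. With c the wedge product by ∑
e_l, one has ∂c + c∂ = n. The map x ↦ (∂x, ∂cx) on Λ³ is therefore injective, and it is onto the two
hook modules because ∂c∂ = n∂.

In the proof these are `hookPair` (the pair (∂, ∂c) on basis triples), `hookPairLift_hookPair` (the
homotopy identity) and `prod_le_span_hookPair` (surjectivity).
`Representation.nonempty_equiv_of_span` turns maps in both directions, inverse up to nonzero scalars
on spanning families, into an equivalence. For n = 3 the second component is zero. -/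

noncomputable section

/-! ### Alternating sums and Specht modules of hook shape -/

namespace SymRep

open Equiv

/-- The tabloid of hook shape whose rows `1, …, k` consist of the entries `u 0, …, u (k-1)`,
all other entries being in row `0`. -/
def hookRow {n k : ℕ} (u : Fin k → Fin n) (x : Fin n) : ℕ :=
  ∑ i, if u i = x then (i : ℕ) + 1 else 0

/-- The basis vector of the row module at a hook tabloid. -/
def hookTabloid {n k : ℕ} (u : Fin k → Fin n) : (Fin n → ℕ) →₀ ℚ :=
  Finsupp.single (hookRow u) 1

/-- The signed sum of a function over all reorderings of its arguments. -/
def altSum {α M : Type*} [AddCommGroup M] [Module ℚ M] {k : ℕ} (h : (Fin k → α) → M)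
    (u : Fin k → α) : M :=
  ∑ σ : Perm (Fin k), ((Perm.sign σ : ℤ) : ℚ) • h (u ∘ σ)

/-- The polytabloid of hook shape whose first column consists of the entries `v 0, …, v k`. -/
def hookPolytabloid {n k : ℕ} (v : Fin (k + 1) → Fin n) : (Fin n → ℕ) →₀ ℚ :=
  altSum (fun u => hookTabloid (u ∘ Fin.succ)) v

section altSum

variable {α M : Type*} [AddCommGroup M] [Module ℚ M]

theorem altSum_comp_perm {k : ℕ} (h : (Fin k → α) → M) (u : Fin k → α) (π : Perm (Fin k)) :
    altSum h (u ∘ π) = ((Perm.sign π : ℤ) : ℚ) • altSum h u := by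
  unfold altSum
  rw [← Equiv.sum_comp (Equiv.mulLeft π) (fun σ => ((Perm.sign σ : ℤ) : ℚ) • h (u ∘ σ)),
    Finset.smul_sum]
  refine Finset.sum_congr rfl fun σ _ => ?_
  have hs : ((Perm.sign π : ℤ) : ℚ) * ((Perm.sign π : ℤ) : ℚ) = 1 := by
    rcases Int.units_eq_one_or (Perm.sign π) with h | h <;> simp [h]
  simp only [Equiv.coe_mulLeft, Perm.sign_mul, Units.val_mul, Int.cast_mul, smul_smul,
    Perm.coe_mul, Function.comp_assoc]
  rw [← mul_assoc, hs, one_mul]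

theorem altSum_swap {k : ℕ} (h : (Fin k → α) → M) (u : Fin k → α) {i j : Fin k} (hij : i ≠ j) :
    altSum h (u ∘ swap i j) = -altSum h u := by
  rw [altSum_comp_perm, Perm.sign_swap hij]
  simp

/-- A repeated entry makes `u` invariant under a transposition, so the sum equals its own negative,
and 2 is invertible. -/
theorem altSum_eq_zero {k : ℕ} (h : (Fin k → α) → M) (u : Fin k → α)
    (hu : ¬ Function.Injective u) : altSum h u = 0 := by
  simp only [Function.Injective, not_forall] at hu
  obtain ⟨i, j, h1, h2⟩ := hu
  have h3 : u ∘ swap i j = u := by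
    funext x
    simp only [Function.comp_apply, swap_apply_def]
    split_ifs with h4 h5
    · rw [h4, h1]
    · rw [h5, h1]
    · rfl
  have h4 := altSum_swap h u h2
  rw [h3] at h4
  have h5 : (2 : ℚ) • altSum h u = 0 := by
    rw [two_smul]
    nth_rewrite 1 [h4]
    simp
  simpa using h5

theorem map_altSum {N : Type*} [AddCommGroup N] [Module ℚ N] (f : M →ₗ[ℚ] N) {k : ℕ}
    (h : (Fin k → α) → M) (u : Fin k → α) : f (altSum h u) = altSum (fun u => f (h u)) u := by
  simp [altSum]

theorem altSum_of_alternating {k : ℕ} (h : (Fin k → α) → M)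
    (hh : ∀ u (σ : Perm (Fin k)), h (u ∘ σ) = ((Perm.sign σ : ℤ) : ℚ) • h u) (u : Fin k → α) :
    altSum h u = (k.factorial : ℚ) • h u := by
  have hs : ∀ π : Perm (Fin k), ((Perm.sign π : ℤ) : ℚ) * ((Perm.sign π : ℤ) : ℚ) = 1 := by
    intro π
    rcases Int.units_eq_one_or (Perm.sign π) with h | h <;> simp [h]
  unfold altSum
  simp only [hh, smul_smul, hs, one_smul, Finset.sum_const, Finset.card_univ, Fintype.card_perm,
    Fintype.card_fin, ← Nat.cast_smul_eq_nsmul ℚ]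

/-- Expansion of a signed sum along the entry that is dropped. -/
theorem altSum_comp_succ {k : ℕ} (h : (Fin k → α) → M) (v : Fin (k + 1) → α) :
    altSum (fun u => h (u ∘ Fin.succ)) v =
      ∑ p : Fin (k + 1), (if p = 0 then (1 : ℚ) else -1) •
        altSum h (v ∘ swap 0 p ∘ Fin.succ) := by
  unfold altSum
  -- `decomposeFin` factors a permutation of `Fin (k + 1)` as `swap 0 p` times a permutation fixing
  -- 0; the entry `v p` is the one dropped.
  rw [← Equiv.sum_comp Perm.decomposeFin.symm, Fintype.sum_prod_type]
  refine Finset.sum_congr rfl fun p _ => ?_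
  rw [Finset.smul_sum]
  refine Finset.sum_congr rfl fun σ _ => ?_
  rw [Perm.decomposeFin.symm_sign, smul_smul]
  congr 1
  · split_ifs <;> simp
  · refine congrArg h (funext fun x => ?_)
    simp [Perm.decomposeFin_symm_apply_succ]

theorem altSum_fin_two (h : (Fin 2 → α) → M) (a b : α) :
    altSum h ![a, b] = h ![a, b] - h ![b, a] := by
  have hu : (Finset.univ : Finset (Perm (Fin 2))) = {1, swap 0 1} := by decide
  have h1 : ![a, b] ∘ swap (0 : Fin 2) 1 = ![b, a] := by
    funext i; fin_cases i <;> simp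
  rw [altSum, hu, Finset.sum_pair (by decide)]
  simp [h1, sub_eq_add_neg]

end altSum

/-- This is the simplicial boundary of a triangle. The sequence `v ∘ swap 0 p ∘ Fin.succ` has `v 0`
in the place vacated by `v p`; sorting it takes p − 1 transpositions, which turns the uniform sign
−1 for p ≠ 0 into (−1)^p. -/
theorem hookPolytabloid_fin_three {n : ℕ} (a b c : Fin n) :
    hookPolytabloid ![a, b, c] = altSum hookTabloid ![b, c] - altSum hookTabloid ![a, c]
      + altSum hookTabloid ![a, b] := by
  have h1 : ![a, b, c] ∘ swap (0 : Fin 3) 0 ∘ Fin.succ = ![b, c] := by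
    funext i; fin_cases i <;> rfl
  have h2 : ![a, b, c] ∘ swap (0 : Fin 3) 1 ∘ Fin.succ = ![a, c] := by
    funext i; fin_cases i <;> rfl
  have h3 : ![a, b, c] ∘ swap (0 : Fin 3) 2 ∘ Fin.succ = ![a, b] ∘ swap (0 : Fin 2) 1 := by
    funext i; fin_cases i <;> rfl
  rw [hookPolytabloid, altSum_comp_succ, Fin.sum_univ_three, h1, h2, h3,
    altSum_swap _ _ (by decide)]
  simp [sub_eq_add_neg]

theorem hookPolytabloid_fin_four {n : ℕ} (a b c d : Fin n) :
    hookPolytabloid ![a, b, c, d] = altSum hookTabloid ![b, c, d]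
      - altSum hookTabloid ![a, c, d] + altSum hookTabloid ![a, b, d]
      - altSum hookTabloid ![a, b, c] := by
  have h1 : ![a, b, c, d] ∘ swap (0 : Fin 4) 0 ∘ Fin.succ = ![b, c, d] := by
    funext i; fin_cases i <;> rfl
  have h2 : ![a, b, c, d] ∘ swap (0 : Fin 4) 1 ∘ Fin.succ = ![a, c, d] := by
    funext i; fin_cases i <;> rfl
  have h3 : ![a, b, c, d] ∘ swap (0 : Fin 4) 2 ∘ Fin.succ = ![a, b, d] ∘ swap (0 : Fin 3) 1 := by
    funext i; fin_cases i <;> rfl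
  have h4 : ![a, b, c, d] ∘ swap (0 : Fin 4) 3 ∘ Fin.succ =
      (![a, b, c] ∘ swap (0 : Fin 3) 1) ∘ swap (1 : Fin 3) 2 := by
    funext i; fin_cases i <;> rfl
  rw [hookPolytabloid, altSum_comp_succ, Fin.sum_univ_four, h1, h2, h3, h4,
    altSum_swap _ _ (by decide), altSum_swap _ _ (by decide), altSum_swap _ _ (by decide)]
  simp [sub_eq_add_neg]

theorem rowModule_hookPolytabloid {n k : ℕ} (π : Perm (Fin n)) (v : Fin (k + 1) → Fin n) :
    rowModule n π (hookPolytabloid v) = hookPolytabloid (π ∘ v) := by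
  rw [hookPolytabloid, map_altSum]
  simp only [hookPolytabloid, altSum]
  refine Finset.sum_congr rfl fun σ _ => ?_
  congr 1
  simp only [hookTabloid, rowModule, MonoidHom.coe_mk, OneHom.coe_mk, Finsupp.lmapDomain_apply,
    Finsupp.mapDomain_single]
  congr 1
  funext x
  simp [hookRow, Equiv.eq_symm_apply]

/-- The polytabloid of a tableau of hook shape depends only on its first column. -/
theorem polytabloid_eq_hookPolytabloid {n k : ℕ} {lam : YoungDiagram} (t : Tableau n lam)
    (v : Fin (k + 1) → Fin n) (hv : ∀ i, (t (v i)).1 = ((i : ℕ), 0))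
    (h0 : ∀ c ∈ lam.cells, c.2 ≠ 0 → c.1 = 0) (hk : ∀ c ∈ lam.cells, c.1 ≤ k) :
    polytabloid t = hookPolytabloid v := by
  have vinj : Function.Injective v := by
    intro i j hij
    have h := hv i
    rw [hij, hv j] at h
    exact Fin.ext (Prod.ext_iff.1 h).1.symm
  have hcol : ∀ x, t.col x = 0 → x = v ⟨t.row x, Nat.lt_succ_of_le (hk _ (t x).2)⟩ := by
    intro x hx
    apply t.injective
    apply Subtype.ext
    rw [hv]
    exact Prod.ext rfl hx
  have hcolv : ∀ i, t.col (v i) = 0 := fun i => by simp [Tableau.col, hv]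
  have hrowv : ∀ i, t.row (v i) = i := fun i => by simp [Tableau.row, hv]
  have hfix : ∀ σ ∈ columnGroup t, ∀ x, t.col x ≠ 0 → σ x = x := by
    intro σ hσ x hx
    have h1 : t.col (σ x) = t.col x := (Finset.mem_filter.1 hσ).2 x
    apply t.injective
    apply Subtype.ext
    refine Prod.ext ?_ h1
    rw [h0 _ (t x).2 hx, h0 _ (t (σ x)).2 (fun e => hx (h1 ▸ e))]
  set vE : Fin (k + 1) ↪ Fin n := ⟨v, vinj⟩ with hvE
  have himg : ∀ (τ : Perm (Fin (k + 1))) i, τ.viaFintypeEmbedding vE (v i) = v (τ i) :=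
    fun τ i => Perm.viaFintypeEmbedding_apply_image τ vE i
  have hout : ∀ (τ : Perm (Fin (k + 1))) x, t.col x ≠ 0 → τ.viaFintypeEmbedding vE x = x := by
    intro τ x hx
    apply Perm.viaFintypeEmbedding_apply_notMem_range
    rintro ⟨i, rfl⟩
    exact hx (hcolv i)
  symm
  unfold polytabloid hookPolytabloid altSum
  -- All columns but the first are single cells, so the column group is the symmetric group of the
  -- first column, extended by the identity.
  refine Finset.sum_bij (fun τ _ => τ.viaFintypeEmbedding vE) ?_ ?_ ?_ ?_
  · intro τ _
    refine Finset.mem_filter.2 ⟨Finset.mem_univ _, fun x => ?_⟩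
    by_cases hx : t.col x = 0
    · rw [hcol x hx, himg, hcolv, hcolv]
    · rw [hout τ x hx]
  · intro τ _ τ' _ h
    ext i
    have h1 := DFunLike.congr_fun h (v i)
    simp only [himg] at h1
    rw [vinj h1]
  · intro σ hσ
    have h1 : ∀ i, t.col (σ (v i)) = 0 := fun i => by
      rw [(Finset.mem_filter.1 hσ).2, hcolv]
    let f : Fin (k + 1) → Fin (k + 1) :=
      fun i => ⟨t.row (σ (v i)), Nat.lt_succ_of_le (hk _ (t _).2)⟩
    have hf : ∀ i, v (f i) = σ (v i) := fun i => (hcol _ (h1 i)).symm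
    have finj : Function.Injective f := by
      intro i j hij
      apply vinj
      apply σ.injective
      rw [← hf, ← hf, hij]
    refine ⟨Equiv.ofBijective f (Finite.injective_iff_bijective.1 finj), Finset.mem_univ _, ?_⟩
    ext1 x
    by_cases hx : t.col x = 0
    · rw [hcol x hx, himg, ← hf]
      rfl
    · rw [hout _ x hx, hfix σ hσ x hx]
  · intro τ _
    rw [Perm.viaFintypeEmbedding_sign]
    congr 1
    simp only [hookTabloid, rowModule, MonoidHom.coe_mk, OneHom.coe_mk, Finsupp.lmapDomain_apply,
      Finsupp.mapDomain_single]
    congr 1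
    funext x
    obtain ⟨y, rfl⟩ := (τ.viaFintypeEmbedding vE).surjective x
    simp only [Function.comp_apply, Perm.inv_def, Equiv.symm_apply_apply, hookRow]
    by_cases hy : t.col y = 0
    · rw [hcol y hy]
      generalize (⟨t.row y, _⟩ : Fin (k + 1)) = i
      rw [himg, hrowv]
      simp only [vinj.eq_iff, τ.injective.eq_iff]
      -- The corner entry `v 0` is absent from the tabloid data and lies in row 0 by default.
      induction i using Fin.cases with
      | zero => simp [Fin.succ_ne_zero]
      | succ i => simp
    · rw [hout τ y hy, Finset.sum_eq_zero]
      · exact (h0 _ (t y).2 hy).symm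
      · intro i _
        rw [if_neg]
        rintro rfl
        exact hy (hcolv _)

/-- Every injective sequence is the first column of some tableau of hook shape. -/
theorem exists_tableau_hook {n k m : ℕ} {lam : YoungDiagram}
    (hlam : ∀ c, c ∈ lam.cells ↔ (c.1 = 0 ∧ c.2 ≤ m) ∨ (c.2 = 0 ∧ c.1 ≤ k))
    (hn : n = m + k + 1) (v : Fin (k + 1) → Fin n) (hv : Function.Injective v) :
    ∃ t : Tableau n lam, ∀ i, (t (v i)).1 = ((i : ℕ), 0) := by
  -- The filling with `0, …, k` down the first column and the other entries along the first row.
  let t₀ : Tableau n lam :=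
    { toFun x := if h : (x : ℕ) ≤ k then ⟨(x, 0), (hlam _).2 (Or.inr ⟨rfl, h⟩)⟩
        else ⟨(0, x - k), (hlam _).2 (Or.inl ⟨rfl, by have := x.2; simp only; omega⟩)⟩
      invFun c := ⟨if c.1.2 = 0 then c.1.1 else k + c.1.2, by
        have := (hlam _).1 c.2
        split_ifs <;> omega⟩
      left_inv x := by
        apply Fin.ext
        by_cases h : (x : ℕ) ≤ k
        · simp [h]
        · simp only [h, dite_false]
          split_ifs <;> omega
      right_inv := by
        rintro ⟨⟨i, j⟩, hc⟩
        have := (hlam _).1 hc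
        simp only at this
        by_cases hj : j = 0
        · subst hj
          have hi : i ≤ k := by omega
          simp [hi]
        · have hi : i = 0 := by omega
          subst hi
          simp [hj] }
  let u : Fin (k + 1) → Fin n := fun i => ⟨i, by omega⟩
  have hu : ∀ i, (t₀ (u i)).1 = ((i : ℕ), 0) := by
    intro i
    have : (u i : ℕ) ≤ k := Nat.le_of_lt_succ i.2
    change (dite ((u i : ℕ) ≤ k) _ _ : {c : ℕ × ℕ // c ∈ lam.cells}).1 = _
    rw [dif_pos this]
  have uinj : Function.Injective u := fun i j h => Fin.ext (Fin.mk.inj h)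
  classical
  -- The bijection between the entries of `v` and those of the first column of `t₀` extends to a
  -- permutation of the finite set `Fin n`.
  let e := (Equiv.ofInjective v hv).symm.trans (Equiv.ofInjective u uinj)
  refine ⟨e.extendSubtype.trans t₀, fun i => ?_⟩
  have h1 : e.extendSubtype (v i) = u i := by
    rw [Equiv.extendSubtype_apply_of_mem e (v i) ⟨i, rfl⟩]
    have : (⟨v i, ⟨i, rfl⟩⟩ : Set.range v) = Equiv.ofInjective v hv i := rfl
    simp only [e, Equiv.trans_apply]
    erw [this]
    rw [Equiv.symm_apply_apply]
    rfl
  rw [Equiv.trans_apply, h1, hu]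

/-- The Specht module of hook shape is spanned by the hook polytabloids. -/
theorem specht_hook_eq {n k m : ℕ} {lam : YoungDiagram}
    (hlam : ∀ c, c ∈ lam.cells ↔ (c.1 = 0 ∧ c.2 ≤ m) ∨ (c.2 = 0 ∧ c.1 ≤ k))
    (hn : n = m + k + 1) :
    (specht n lam).toSubmodule =
      Submodule.span ℚ (Set.range (hookPolytabloid : (Fin (k + 1) → Fin n) → _)) := by
  have h0 : ∀ c ∈ lam.cells, c.2 ≠ 0 → c.1 = 0 := fun c hc => by
    have := (hlam c).1 hc
    omega
  have hk : ∀ c ∈ lam.cells, c.1 ≤ k := fun c hc => by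
    have := (hlam c).1 hc
    omega
  apply le_antisymm <;> refine Submodule.span_le.2 ?_ <;> rintro _ ⟨x, rfl⟩
  · refine Submodule.subset_span
      ⟨fun i => x.symm ⟨((i : ℕ), 0), (hlam _).2 (Or.inr ⟨rfl, Nat.le_of_lt_succ i.2⟩)⟩, ?_⟩
    exact (polytabloid_eq_hookPolytabloid x _ (fun i => by rw [Equiv.apply_symm_apply]) h0 hk).symm
  · by_cases hx : Function.Injective x
    · obtain ⟨t, ht⟩ := exists_tableau_hook hlam hn x hx
      exact Submodule.subset_span ⟨t, polytabloid_eq_hookPolytabloid t x ht h0 hk⟩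
    · rw [hookPolytabloid, altSum_eq_zero _ _ hx]
      exact Submodule.zero_mem _

theorem mem_ofRowLens_hook {m k : ℕ} (h : ((m + 1) :: List.replicate k 1).SortedGE) (c : ℕ × ℕ) :
    c ∈ (YoungDiagram.ofRowLens _ h).cells ↔ (c.1 = 0 ∧ c.2 ≤ m) ∨ (c.2 = 0 ∧ c.1 ≤ k) := by
  rw [YoungDiagram.mem_cells, YoungDiagram.mem_ofRowLens]
  obtain ⟨i, j⟩ := c
  cases i with
  | zero => simp; omega
  | succ i => simp; omega

end SymRep

/-! ### The degree-two relations: alternation and spanning -/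

namespace Arnold

open Equiv

/-- The relation `YB` as a function of a triple of indices. -/
def YBv {n : ℕ} (v : Fin 3 → Fin n) : Ext n := YB (v 0) (v 1) (v 2)

theorem YBv_comp_perm {n : ℕ} (v : Fin 3 → Fin n) (σ : Perm (Fin 3)) :
    YBv (v ∘ σ) = ((Perm.sign σ : ℤ) : ℚ) • YBv v := by
  have h01 : ∀ v : Fin 3 → Fin n, YBv (v ∘ swap 0 1) = -YBv v := fun v => by
    simpa [YBv, swap_apply_of_ne_of_ne] using YB_swap_left (v 0) (v 1) (v 2)
  have h12 : ∀ v : Fin 3 → Fin n, YBv (v ∘ swap 1 2) = -YBv v := fun v => by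
    simpa [YBv, swap_apply_of_ne_of_ne] using YB_swap_right (v 0) (v 1) (v 2)
  have key : ∀ (v : Fin 3 → Fin n) (i j : Fin 3), i ≠ j → YBv (v ∘ swap i j) = -YBv v := by
    have h02 : ∀ v : Fin 3 → Fin n, YBv (v ∘ swap 0 2) = -YBv v := fun v => by
      have e : (swap (0 : Fin 3) 2) = swap 0 1 * (swap 1 2 * swap 0 1) := by decide
      rw [e, Perm.coe_mul, ← Function.comp_assoc, Perm.coe_mul, ← Function.comp_assoc, h01, h12,
        h01, neg_neg]
    intro v i j hij
    fin_cases i <;> fin_cases j <;> first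
      | exact absurd rfl hij
      | exact h01 v
      | exact h02 v
      | exact h12 v
  induction σ using Perm.swap_induction_on generalizing v with
  | one => simp
  | swap_mul σ i j hij ih =>
    rw [Perm.coe_mul, ← Function.comp_assoc, ih, key v i j hij, Perm.sign_mul,
      Perm.sign_swap hij]
    simp

/-- By alternation the signed sum over reorderings is 3! times `YBv v`, and that sum vanishes on a
repeated index. -/
theorem YBv_eq_zero {n : ℕ} (v : Fin 3 → Fin n) (hv : ¬ Function.Injective v) : YBv v = 0 := by
  have h := SymRep.altSum_of_alternating YBv YBv_comp_perm v
  rw [SymRep.altSum_eq_zero _ _ hv] at h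
  simpa [Nat.factorial] using h.symm

theorem w_mem_range {n : ℕ} (i j : Fin n) :
    w i j ∈ LinearMap.range (ExteriorAlgebra.ι ℚ : (Pair n →₀ ℚ) →ₗ[ℚ] Ext n) := by
  unfold w
  split_ifs
  · exact Submodule.zero_mem _
  · exact ⟨_, rfl⟩

theorem YB_mem_exteriorPower {n : ℕ} (i j k : Fin n) : YB i j k ∈ ⋀[ℚ]^2 (Pair n →₀ ℚ) := by
  have h : ∀ a b c d : Fin n, w a b * w c d ∈ ⋀[ℚ]^2 (Pair n →₀ ℚ) := fun a b c d => by
    rw [ExteriorAlgebra.exteriorPower, pow_two]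
    exact Submodule.mul_mem_mul (w_mem_range a b) (w_mem_range c d)
  exact Submodule.add_mem _ (Submodule.sub_mem _ (h _ _ _ _) (h _ _ _ _)) (h _ _ _ _)

theorem YBv_mem_I2 {n : ℕ} (v : Fin 3 → Fin n) : YBv v ∈ I2 n := by
  by_cases hv : Function.Injective v
  · exact ⟨YB_mem (fun e => absurd (hv e) (by decide)) (fun e => absurd (hv e) (by decide))
      (fun e => absurd (hv e) (by decide)), YB_mem_exteriorPower _ _ _⟩
  · rw [YBv_eq_zero v hv]
    exact Submodule.zero_mem _

/-- In a graded algebra over a field whose degree zero part consists of scalars, the homogeneous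
component, in the degree of the generators, of a two-sided ideal generated by homogeneous elements
of one degree is spanned by the generators. -/
theorem decompose_mem_span_of_mem_ideal_span {K A : Type*} [Field K] [Ring A] [Algebra K A]
    (𝒜 : ℕ → Submodule K A) [GradedAlgebra 𝒜] (h𝒜 : 𝒜 0 ≤ 1) {d : ℕ} {s : Set A}
    (hs : ∀ y ∈ s, y ∈ 𝒜 d) {x : A} (hx : x ∈ TwoSidedIdeal.span s) :
    (DirectSum.decompose 𝒜 x d : A) ∈ Submodule.span K s := by
  rw [TwoSidedIdeal.mem_span_iff_mem_addSubgroup_closure] at hx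
  induction hx using AddSubgroup.closure_induction with
  | zero => simp
  | add x y _ _ hx hy =>
    rw [DirectSum.decompose_add, DirectSum.add_apply, Submodule.coe_add]
    exact Submodule.add_mem _ hx hy
  | neg x _ hx =>
    rw [DirectSum.decompose_neg]
    exact Submodule.neg_mem _ hx
  | mem x hx =>
    obtain ⟨_, ⟨a, _, y, hy, rfl⟩, b, _, rfl⟩ := hx
    have hyd := hs y hy
    simp only
    clear * - hyd hy h𝒜
    induction b using DirectSum.Decomposition.inductionOn 𝒜 with
    | zero => simp
    | add b c hb hc =>
      rw [mul_add, DirectSum.decompose_add, DirectSum.add_apply, Submodule.coe_add]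
      exact Submodule.add_mem _ hb hc
    | @homogeneous i b =>
      -- If `b` has degree zero it is a scalar, and only the degree-zero component of `a`, again a
      -- scalar, contributes in degree `d`.
      by_cases hi : i = 0
      · subst hi
        obtain ⟨r, hr⟩ := Submodule.mem_one.1 (h𝒜 b.2)
        obtain ⟨r', hr'⟩ := Submodule.mem_one.1 (h𝒜 (DirectSum.decompose 𝒜 a 0).2)
        rw [DirectSum.coe_decompose_mul_of_right_mem_zero 𝒜 b.2]
        have h := DirectSum.coe_decompose_mul_add_of_right_mem 𝒜 (i := 0) (a := a) hyd
        rw [zero_add] at h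
        rw [h, ← hr, ← hr', ← Algebra.commutes, ← Algebra.smul_def, ← Algebra.smul_def]
        exact Submodule.smul_mem _ _ (Submodule.smul_mem _ _ (Submodule.subset_span hy))
      -- For `b` of positive degree, `a * y` would need a component in degree `d - i`, below the
      -- degree of `y`.
      · by_cases hid : i ≤ d
        · rw [DirectSum.coe_decompose_mul_of_right_mem_of_le 𝒜 b.2 hid,
            DirectSum.coe_decompose_mul_of_right_mem_of_not_le 𝒜 hyd (by omega), zero_mul]
          exact Submodule.zero_mem _
        · rw [DirectSum.coe_decompose_mul_of_right_mem_of_not_le 𝒜 b.2 hid]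
          exact Submodule.zero_mem _

theorem I2_le_span {n : ℕ} :
    I2 n ≤ Submodule.span ℚ {x | ∃ i j k : Fin n, i < j ∧ j < k ∧ x = YB i j k} := by
  rintro x ⟨hx, hx2⟩
  have h := decompose_mem_span_of_mem_ideal_span (fun i : ℕ => ⋀[ℚ]^i (Pair n →₀ ℚ)) (d := 2)
    (by simp [ExteriorAlgebra.exteriorPower])
    (by rintro _ ⟨i, j, k, _, _, rfl⟩; exact YB_mem_exteriorPower i j k)
    (TwoSidedIdeal.mem_asIdeal.1 hx)
  rwa [DirectSum.decompose_of_mem_same (fun i : ℕ => ⋀[ℚ]^i (Pair n →₀ ℚ)) hx2] at h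

/-- All triples are admitted as indices, degenerate ones contributing zero, so that the group acts
on the index set without any sorting. -/
theorem I2_eq_span (n : ℕ) :
    I2 n = Submodule.span ℚ (Set.range (YBv : (Fin 3 → Fin n) → Ext n)) := by
  apply le_antisymm
  · refine I2_le_span.trans (Submodule.span_mono ?_)
    rintro _ ⟨i, j, k, _, _, rfl⟩
    exact ⟨![i, j, k], rfl⟩
  · rw [Submodule.span_le]
    rintro _ ⟨v, rfl⟩
    exact YBv_mem_I2 v

theorem action_YBv {n : ℕ} (π : Perm (Fin n)) (v : Fin 3 → Fin n) :
    action n π (YBv v) = YBv (π ∘ v) := action_YB _ _ _ _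

/-! ### Coordinates detecting the relations -/

/-- The coordinate of the vector space of generators that belongs to the pair `{i, j}`. -/
def pairCoord {n : ℕ} (i j : Fin n) : Module.Dual ℚ (Pair n →₀ ℚ) :=
  Finsupp.linearCombination ℚ (fun p : Pair n => if p.1 = s(i, j) then (1 : ℚ) else 0)

/-- The coordinate functional on the exterior algebra that belongs to the product of the
coordinates `d` and `d'`. -/
def prodCoord {M : Type*} [AddCommGroup M] [Module ℚ M] (d d' : Module.Dual ℚ M) :
    ExteriorAlgebra ℚ M →ₗ[ℚ] ℚ :=
  (ExteriorAlgebra.algebraMapInv : ExteriorAlgebra ℚ M →ₐ[ℚ] ℚ).toLinearMap ∘ₗ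
    CliffordAlgebra.contractLeft d' ∘ₗ CliffordAlgebra.contractLeft d

/-- Contraction is an antiderivation, so two successive contractions produce a 2 × 2 determinant. -/
theorem prodCoord_ι_mul_ι {M : Type*} [AddCommGroup M] [Module ℚ M] (d d' : Module.Dual ℚ M)
    (x y : M) : prodCoord d d' (ExteriorAlgebra.ι ℚ x * ExteriorAlgebra.ι ℚ y) =
      d x * d' y - d y * d' x := by
  have h := CliffordAlgebra.contractLeft_ι_mul (Q := (0 : QuadraticForm ℚ M)) (d := d) x
    (CliffordAlgebra.ι _ y)
  simp only [prodCoord, LinearMap.comp_apply, ExteriorAlgebra.ι]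
  rw [h]
  simp [CliffordAlgebra.contractLeft_mul_algebraMap, CliffordAlgebra.contractLeft_ι, mul_comm]

theorem prodCoord_w_mul_w {n : ℕ} (d d' : Module.Dual ℚ (Pair n →₀ ℚ)) {i j k l : Fin n}
    (hij : i ≠ j) (hkl : k ≠ l) : prodCoord d d' (w i j * w k l) =
      d (Finsupp.single ⟨s(i, j), by simpa using hij⟩ 1) *
        d' (Finsupp.single ⟨s(k, l), by simpa using hkl⟩ 1) -
      d (Finsupp.single ⟨s(k, l), by simpa using hkl⟩ 1) *
        d' (Finsupp.single ⟨s(i, j), by simpa using hij⟩ 1) := by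
  simp only [w, hij, hkl, dite_false]
  exact prodCoord_ι_mul_ι _ _ _ _

theorem pairCoord_single {n : ℕ} (i j : Fin n) (p : Pair n) :
    pairCoord i j (Finsupp.single p 1) = if p.1 = s(i, j) then 1 else 0 := by
  simp [pairCoord]

/-- Pairing `YB` with the product of the coordinates `w_{ij}` and `w_{ik}`. -/
theorem prodCoord_YBv {n : ℕ} {v u : Fin 3 → Fin n} (hv : Function.Injective v)
    (hu : Function.Injective u) :
    prodCoord (pairCoord (u 0) (u 1)) (pairCoord (u 0) (u 2)) (YBv v) =
      ∑ σ : Perm (Fin 3), ((Perm.sign σ : ℤ) : ℚ) * if v ∘ σ = u then 1 else 0 := by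
  have huniv : (Finset.univ : Finset (Perm (Fin 3))) =
      {1, swap 0 1, swap 0 2, swap 1 2, swap 0 1 * swap 1 2, swap 1 2 * swap 0 1} := by decide
  have e1 : Perm.sign (swap (0 : Fin 3) 1 * swap 1 2) = 1 := by decide
  have e2 : Perm.sign (swap (1 : Fin 3) 2 * swap 0 1) = 1 := by decide
  have e3 : Perm.sign (swap (0 : Fin 3) 1) = -1 := by decide
  have e4 : Perm.sign (swap (0 : Fin 3) 2) = -1 := by decide
  have e5 : Perm.sign (swap (1 : Fin 3) 2) = -1 := by decide
  have hab : v 0 ≠ v 1 := hv.ne (by decide)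
  have hac : v 0 ≠ v 2 := hv.ne (by decide)
  have hbc : v 1 ≠ v 2 := hv.ne (by decide)
  have hij : u 0 ≠ u 1 := hu.ne (by decide)
  have hik : u 0 ≠ u 2 := hu.ne (by decide)
  have hjk : u 1 ≠ u 2 := hu.ne (by decide)
  have hfun : ∀ σ : Perm (Fin 3),
      v ∘ σ = u ↔ v (σ 0) = u 0 ∧ v (σ 1) = u 1 ∧ v (σ 2) = u 2 := fun σ => by
    rw [funext_iff, Fin.forall_fin_succ, Fin.forall_fin_succ, Fin.forall_fin_one]
    rfl
  have s1 : swap (0 : Fin 3) 1 2 = 2 := by decide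
  have s2 : swap (0 : Fin 3) 2 1 = 1 := by decide
  have s3 : swap (1 : Fin 3) 2 0 = 0 := by decide
  rw [huniv, Finset.sum_insert (by decide), Finset.sum_insert (by decide),
    Finset.sum_insert (by decide), Finset.sum_insert (by decide), Finset.sum_pair (by decide)]
  simp only [hfun]
  simp only [e1, e2, e3, e4, e5, Perm.sign_one, Perm.coe_mul, Function.comp_apply,
    Perm.coe_one, id_eq, swap_apply_left, swap_apply_right, s1, s2, s3]
  unfold YBv YB
  obtain ⟨a, ha⟩ : ∃ a, v 0 = a := ⟨_, rfl⟩
  obtain ⟨b, hb⟩ : ∃ b, v 1 = b := ⟨_, rfl⟩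
  obtain ⟨c, hc⟩ : ∃ c, v 2 = c := ⟨_, rfl⟩
  obtain ⟨i, hi⟩ : ∃ i, u 0 = i := ⟨_, rfl⟩
  obtain ⟨j, hj⟩ : ∃ j, u 1 = j := ⟨_, rfl⟩
  obtain ⟨k, hk⟩ : ∃ k, u 2 = k := ⟨_, rfl⟩
  simp only [ha, hb, hc, hi, hj, hk] at hab hac hbc hij hik hjk ⊢
  clear * - hab hac hbc hij hik hjk
  have hij' := hij.symm
  have hik' := hik.symm
  rw [map_add, map_sub, prodCoord_w_mul_w _ _ hab hac, prodCoord_w_mul_w _ _ hab hbc,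
    prodCoord_w_mul_w _ _ hac hbc]
  simp only [pairCoord_single, Sym2.eq_iff]
  -- The two edges in each term of `YB` share one vertex, a different one in each term. Only the
  -- term whose shared vertex is `i` can pair nontrivially, hence the cases on which of `a`, `b`,
  -- `c` equals `i`.
  by_cases h1 : a = i
  · subst h1
    by_cases h2 : b = j <;> by_cases h3 : b = k <;> by_cases h4 : c = j <;>
      by_cases h5 : c = k <;> simp_all
  · by_cases h2 : b = i
    · subst h2
      by_cases h2 : a = j <;> by_cases h3 : a = k <;> by_cases h4 : c = j <;>
        by_cases h5 : c = k <;> simp_all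
    · by_cases h3 : c = i
      · subst h3
        by_cases h2 : a = j <;> by_cases h3 : a = k <;> by_cases h4 : b = j <;>
          by_cases h5 : b = k <;> simp_all
      · simp_all

/-- Summing an alternating function against the coordinates of a relation. -/
theorem sum_prodCoord_YBv {n : ℕ} {M : Type*} [AddCommGroup M] [Module ℚ M]
    (T : (Fin 3 → Fin n) → M) (hT₀ : ∀ u, ¬ Function.Injective u → T u = 0)
    (hT : ∀ u (σ : Perm (Fin 3)), T (u ∘ σ) = ((Perm.sign σ : ℤ) : ℚ) • T u)
    (v : Fin 3 → Fin n) :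
    ∑ u : Fin 3 → Fin n, prodCoord (pairCoord (u 0) (u 1)) (pairCoord (u 0) (u 2)) (YBv v) • T u
      = (6 : ℚ) • T v := by
  by_cases hv : Function.Injective v
  · have h : ∀ u : Fin 3 → Fin n,
        prodCoord (pairCoord (u 0) (u 1)) (pairCoord (u 0) (u 2)) (YBv v) • T u =
          ∑ σ : Perm (Fin 3), if v ∘ σ = u then ((Perm.sign σ : ℤ) : ℚ) • T u else 0 := by
      intro u
      by_cases hu : Function.Injective u
      · rw [prodCoord_YBv hv hu, Finset.sum_smul]
        refine Finset.sum_congr rfl fun σ _ => ?_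
        split_ifs <;> simp
      · simp [hT₀ u hu]
    have h6 := SymRep.altSum_of_alternating T hT v
    simp only [h]
    rw [Finset.sum_comm]
    simp only [Finset.sum_ite_eq, Finset.mem_univ, if_true]
    exact h6
  · simp [YBv_eq_zero v hv, hT₀ v hv]

end Arnold

/-! ### Equivalence of representations from matching spanning families -/

theorem Finsupp.range_linearCombination_eq_top {K P P' Γ : Type*} [Field K] [AddCommGroup P]
    [Module K P] [AddCommGroup P'] [Module K P'] (l : P →ₗ[K] P') (hl : Function.Injective l)
    (z : Γ → P) (hz : LinearMap.range l ≤ Submodule.span K (Set.range fun γ => l (z γ))) :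
    LinearMap.range (Finsupp.linearCombination K z) = ⊤ := by
  rw [Finsupp.range_linearCombination, eq_top_iff, ← Submodule.map_le_map_iff_of_injective hl,
    Submodule.map_span, ← Set.range_comp, Submodule.map_top]
  exact hz

/-- Two representations are equivalent if they are spanned by families that are permuted in the
same way by the group and that satisfy the same linear relations; the latter is ensured by linear
maps in both directions, between larger spaces, that match the two families up to scalars. -/
theorem Representation.nonempty_equiv_of_span {K G M N M' N' Γ : Type*} [Field K] [Monoid G]
    [AddCommGroup M] [Module K M] [AddCommGroup N] [Module K N] [AddCommGroup M'] [Module K M']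
    [AddCommGroup N'] [Module K N'] {ρ : Representation K G M} {σ : Representation K G N}
    (act : G → Γ → Γ) (x : Γ → M) (y : Γ → N)
    (hρ : ∀ g γ, ρ g (x γ) = x (act g γ)) (hσ : ∀ g γ, σ g (y γ) = y (act g γ))
    (i : M →ₗ[K] M') (j : N →ₗ[K] N') (hi : Function.Injective i) (hj : Function.Injective j)
    (hx : LinearMap.range i ≤ Submodule.span K (Set.range fun γ => i (x γ)))
    (hy : LinearMap.range j ≤ Submodule.span K (Set.range fun γ => j (y γ)))
    (f : M' →ₗ[K] N') (g : N' →ₗ[K] M') {a b : K} (ha : a ≠ 0) (hb : b ≠ 0)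
    (hf : ∀ γ, f (i (x γ)) = a • j (y γ)) (hg : ∀ γ, g (j (y γ)) = b • i (x γ)) :
    Nonempty (ρ.Equiv σ) := by
  have hX := Finsupp.range_linearCombination_eq_top i hi x hx
  have hY := Finsupp.range_linearCombination_eq_top j hj y hy
  set X := Finsupp.linearCombination K x
  set Y := Finsupp.linearCombination K y
  have hfX : ∀ c, f (i (X c)) = a • j (Y c) := by
    intro c
    have : f ∘ₗ i ∘ₗ X = a • (j ∘ₗ Y) := by
      ext γ
      simp [X, Y, hf]
    exact LinearMap.congr_fun this c
  have hgY : ∀ c, g (j (Y c)) = b • i (X c) := by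
    intro c
    have : g ∘ₗ j ∘ₗ Y = b • (i ∘ₗ X) := by
      ext γ
      simp [X, Y, hg]
    exact LinearMap.congr_fun this c
  -- `f` carries every relation among the `x γ` to one among the `y γ`, and `g` carries them back;
  -- the scalars are cancelled.
  have hker : LinearMap.ker X = LinearMap.ker Y := by
    ext c
    rw [LinearMap.mem_ker, LinearMap.mem_ker]
    constructor
    · intro h
      have h1 := hfX c
      rw [h, map_zero, map_zero] at h1
      exact hj (by simpa [ha] using h1.symm)
    · intro h
      have h1 := hgY c
      rw [h, map_zero, map_zero] at h1
      exact hi (by simpa [hb] using h1.symm)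
  -- Both spaces are the quotient of the free module on `Γ` by this common kernel.
  let e : M ≃ₗ[K] N := (X.quotKerEquivOfSurjective (LinearMap.range_eq_top.1 hX)).symm ≪≫ₗ
    Submodule.quotEquivOfEq _ _ hker ≪≫ₗ
    Y.quotKerEquivOfSurjective (LinearMap.range_eq_top.1 hY)
  have he : ∀ γ, e (x γ) = y γ := by
    intro γ
    have h1 : X (Finsupp.single γ 1) = x γ := by simp [X]
    have h2 : Y (Finsupp.single γ 1) = y γ := by simp [Y]
    have h3 : (X.quotKerEquivOfSurjective (LinearMap.range_eq_top.1 hX)).symm (x γ) =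
        Submodule.Quotient.mk (Finsupp.single γ 1) := by
      rw [LinearEquiv.symm_apply_eq]
      exact h1.symm
    simp only [e, LinearEquiv.trans_apply, h3, Submodule.quotEquivOfEq_mk]
    exact h2
  refine ⟨Representation.Equiv.mk e fun s => ?_⟩
  refine LinearMap.ext_on_range (v := x) ?_ ?_
  · rw [← Finsupp.range_linearCombination, hX]
  · intro γ
    simp [hρ, hσ, he]

/-! ### Linear maps out of the row module -/

namespace SymRep

open Equiv

/-- Ensures that exactly one summand of `rowLift` survives at a hook tabloid with distinct entries.
-/
theorem hookRow_eq_iff {n k : ℕ} {u : Fin k → Fin n} (hu : Function.Injective u)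
    (u' : Fin k → Fin n) : (∀ i, hookRow u (u' i) = (i : ℕ) + 1) ↔ u = u' := by
  have h : ∀ j, hookRow u (u j) = (j : ℕ) + 1 := fun j => by simp [hookRow, hu.eq_iff]
  constructor
  · intro h'
    funext i
    -- An entry outside the range of `u` lies in row 0, never in row `i + 1`.
    have hex : ∃ j, u j = u' i := by
      by_contra hne
      push Not at hne
      have h2 := h' i
      rw [hookRow, Finset.sum_eq_zero (fun j _ => if_neg (hne j))] at h2
      omega
    obtain ⟨j, hj⟩ := hex
    have h1 := h' i
    rw [← hj, h j] at h1
    rw [← hj, Fin.ext (Nat.succ_injective h1)]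
  · rintro rfl
    exact h

/-- Linear extension to the row module of a function of the entries of a hook tabloid outside
row `0`. -/
def rowLift {n k : ℕ} {M : Type*} [AddCommGroup M] [Module ℚ M] (h : (Fin k → Fin n) → M) :
    ((Fin n → ℕ) →₀ ℚ) →ₗ[ℚ] M :=
  Finsupp.linearCombination ℚ
    fun f => ∑ u : Fin k → Fin n, if ∀ i, f (u i) = (i : ℕ) + 1 then h u else 0

theorem rowLift_altSum {n k : ℕ} {M : Type*} [AddCommGroup M] [Module ℚ M]
    (h : (Fin k → Fin n) → M) (u : Fin k → Fin n) :
    rowLift h (altSum hookTabloid u) = altSum h u := by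
  by_cases hu : Function.Injective u
  · rw [map_altSum]
    refine Finset.sum_congr rfl fun σ _ => ?_
    congr 1
    simp [rowLift, hookTabloid, hookRow_eq_iff (hu.comp σ.injective)]
  · rw [altSum_eq_zero _ _ hu, altSum_eq_zero _ _ hu, map_zero]

end SymRep

/-! ### The Koszul splitting into two hook modules -/

namespace Arnold

open Equiv SymRep

/-- The linear map on the exterior algebra that sends a relation `YB` to six times the value of
an alternating function `T`. -/
def relMap {n : ℕ} {M : Type*} [AddCommGroup M] [Module ℚ M] (T : (Fin 3 → Fin n) → M) :
    Ext n →ₗ[ℚ] M :=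
  ∑ u : Fin 3 → Fin n,
    (prodCoord (pairCoord (u 0) (u 1)) (pairCoord (u 0) (u 2))).smulRight (T u)

theorem relMap_YBv {n : ℕ} {M : Type*} [AddCommGroup M] [Module ℚ M] (T : (Fin 3 → Fin n) → M)
    (hT₀ : ∀ u, ¬ Function.Injective u → T u = 0)
    (hT : ∀ u (σ : Perm (Fin 3)), T (u ∘ σ) = ((Perm.sign σ : ℤ) : ℚ) • T u)
    (v : Fin 3 → Fin n) : relMap T (YBv v) = (6 : ℚ) • T v := by
  rw [← sum_prodCoord_YBv T hT₀ hT v]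
  simp [relMap]

/-- The sum of the polytabloids of shape `(n - k - 1, 1, …, 1)` whose first column extends
a given sequence by one entry. -/
def coneSum {n k : ℕ} (v : Fin (k + 1) → Fin n) : (Fin n → ℕ) →₀ ℚ :=
  ∑ l, hookPolytabloid (Matrix.vecCons l v)

theorem coneSum_eq_zero {n k : ℕ} (v : Fin (k + 1) → Fin n) (hv : ¬ Function.Injective v) :
    coneSum v = 0 := by
  refine Finset.sum_eq_zero fun l _ => altSum_eq_zero _ _ fun h => hv ?_
  exact (h.comp (Fin.succ_injective _) :)

theorem coneSum_comp_perm {n k : ℕ} (v : Fin (k + 1) → Fin n) (σ : Perm (Fin (k + 1))) :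
    coneSum (v ∘ σ) = ((Perm.sign σ : ℤ) : ℚ) • coneSum v := by
  unfold coneSum
  rw [Finset.smul_sum]
  refine Finset.sum_congr rfl fun l _ => ?_
  have h : Matrix.vecCons l (v ∘ σ) = Matrix.vecCons l v ∘ Perm.decomposeFin.symm (0, σ) := by
    funext i
    refine Fin.cases ?_ (fun i => ?_) i
    · simp
    · simp [Perm.decomposeFin_symm_apply_succ]
  rw [h, hookPolytabloid, altSum_comp_perm, Perm.decomposeFin.symm_sign]
  simp [hookPolytabloid]

/-- The image of the relation `YB` in the sum of the two hook representations. -/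
def hookPair {n : ℕ} (v : Fin 3 → Fin n) : ((Fin n → ℕ) →₀ ℚ) × ((Fin n → ℕ) →₀ ℚ) :=
  (hookPolytabloid v, coneSum v)

theorem relMap_hookPair {n : ℕ} (v : Fin 3 → Fin n) :
    relMap hookPair (YBv v) = (6 : ℚ) • hookPair v := by
  refine relMap_YBv _ (fun u hu => ?_) (fun u σ => ?_) v
  · rw [hookPair, coneSum_eq_zero u hu, hookPolytabloid, altSum_eq_zero _ _ hu]
    rfl
  · rw [hookPair, coneSum_comp_perm, hookPolytabloid, altSum_comp_perm]
    rfl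

/-- The sum of the relations that contain two given indices. -/
def starSum {n : ℕ} (u : Fin 2 → Fin n) : Ext n := ∑ l, YB l (u 0) (u 1)

/-- The map in the direction opposite to `relMap hookPair`. -/
def hookPairLift (n : ℕ) : ((Fin n → ℕ) →₀ ℚ) × ((Fin n → ℕ) →₀ ℚ) →ₗ[ℚ] Ext n :=
  LinearMap.coprod ((3 : ℚ) • rowLift starSum) (rowLift YBv)

theorem rowLift_starSum {n : ℕ} (b c : Fin n) :
    rowLift starSum (altSum hookTabloid ![b, c]) = (2 : ℚ) • ∑ l, YB l b c := by
  rw [rowLift_altSum, altSum_fin_two]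
  simp only [starSum, Matrix.cons_val_zero, Matrix.cons_val_one]
  rw [Finset.sum_congr rfl (fun l _ => YB_swap_right l b c), Finset.sum_neg_distrib, two_smul,
    sub_neg_eq_add]

theorem rowLift_YBv {n : ℕ} (v : Fin 3 → Fin n) :
    rowLift YBv (altSum hookTabloid v) = (6 : ℚ) • YBv v := by
  rw [rowLift_altSum, altSum_of_alternating _ YBv_comp_perm]
  norm_num [Nat.factorial]

theorem vec_three {α : Type*} (v : Fin 3 → α) : v = ![v 0, v 1, v 2] := by
  funext i; fin_cases i <;> rfl

theorem vec_four {α : Type*} (v : Fin 4 → α) : v = ![v 0, v 1, v 2, v 3] := by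
  funext i; fin_cases i <;> rfl

/-- This is the homotopy identity ∂c + c∂ = n: the first component supplies c∂ and the second ∂c.
The factor 3 in `hookPairLift` makes up the difference between the 2! of a two-entry alternating sum
and the 3! of a three-entry one. -/
theorem hookPairLift_hookPair {n : ℕ} (v : Fin 3 → Fin n) :
    hookPairLift n (hookPair v) = (6 * n : ℚ) • YBv v := by
  rw [vec_three v]
  generalize v 0 = a
  generalize v 1 = b
  generalize v 2 = c
  have h1 : rowLift starSum (hookPolytabloid ![a, b, c]) =
      (2 : ℚ) • ∑ l, (YB l b c - YB l a c + YB l a b) := by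
    rw [hookPolytabloid_fin_three, map_add, map_sub, rowLift_starSum, rowLift_starSum,
      rowLift_starSum, ← smul_sub, ← smul_add, Finset.sum_add_distrib, Finset.sum_sub_distrib]
  have h2 : rowLift YBv (coneSum ![a, b, c]) =
      (6 : ℚ) • ∑ l, (YB a b c - YB l b c + YB l a c - YB l a b) := by
    rw [coneSum, map_sum, Finset.smul_sum]
    refine Finset.sum_congr rfl fun l _ => ?_
    rw [hookPolytabloid_fin_four, map_sub, map_add, map_sub, rowLift_YBv, rowLift_YBv,
      rowLift_YBv, rowLift_YBv, ← smul_sub, ← smul_add, ← smul_sub]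
    rfl
  simp only [hookPairLift, hookPair, LinearMap.coprod_apply, LinearMap.smul_apply]
  rw [h1, h2, smul_smul]
  norm_num only
  rw [← smul_add, ← Finset.sum_add_distrib, mul_smul]
  congr 1
  -- For each `l` the faces containing `l` cancel, so each of the n summands leaves `YB a b c`.
  have h3 : ∀ l : Fin n, YB l b c - YB l a c + YB l a b +
      (YB a b c - YB l b c + YB l a c - YB l a b) = YB a b c := fun l => by abel
  simp only [h3, Finset.sum_const, Finset.card_univ, Fintype.card_fin]
  rw [Nat.cast_smul_eq_nsmul]
  rfl

/-- The polytabloids of the second hook shape are combinations of the elements `hookPair`. -/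
theorem hookPair_boundary {n : ℕ} (a b c d : Fin n) :
    hookPair ![b, c, d] - hookPair ![a, c, d] + hookPair ![a, b, d] - hookPair ![a, b, c] =
      (n : ℚ) • ((0, hookPolytabloid ![a, b, c, d]) :
        ((Fin n → ℕ) →₀ ℚ) × ((Fin n → ℕ) →₀ ℚ)) := by
  refine Prod.ext ?_ ?_
  -- The boundary of a boundary vanishes.
  · simp only [hookPair, Prod.fst_sub, Prod.fst_add, Prod.smul_fst, smul_zero,
      hookPolytabloid_fin_three]
    abel
  · simp only [hookPair, Prod.snd_sub, Prod.snd_add, Prod.smul_snd, coneSum]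
    rw [← Finset.sum_sub_distrib, ← Finset.sum_add_distrib, ← Finset.sum_sub_distrib]
    -- The identity ∂(e_l ∧ x) = x − e_l ∧ ∂x for x = ∂[a, b, c, d], where ∂x = 0.
    have h : ∀ l : Fin n, hookPolytabloid ![l, b, c, d] - hookPolytabloid ![l, a, c, d]
        + hookPolytabloid ![l, a, b, d] - hookPolytabloid ![l, a, b, c]
        = hookPolytabloid ![a, b, c, d] := fun l => by
      simp only [hookPolytabloid_fin_four]
      abel
    rw [Finset.sum_congr rfl fun l _ => h l, Finset.sum_const, Finset.card_univ,
      Fintype.card_fin, Nat.cast_smul_eq_nsmul]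

/-- Dividing `hookPair_boundary` by n isolates the second summand. Since `coneSum v` is a sum of its
generators, subtracting `(0, coneSum v)` from `hookPair v` then isolates the first. -/
theorem prod_le_span_hookPair {n : ℕ} (hn : n ≠ 0) :
    (Submodule.span ℚ (Set.range (hookPolytabloid : (Fin 3 → Fin n) → _))).prod
      (Submodule.span ℚ (Set.range (hookPolytabloid : (Fin 4 → Fin n) → _))) ≤
    Submodule.span ℚ (Set.range (hookPair : (Fin 3 → Fin n) → _)) := by
  set W := Submodule.span ℚ (Set.range (hookPair : (Fin 3 → Fin n) → _))
  have hW : ∀ v, hookPair v ∈ W := fun v => Submodule.subset_span ⟨v, rfl⟩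
  have h4 : ∀ v : Fin 4 → Fin n, (0, hookPolytabloid v) ∈ W := by
    intro v
    have h := W.smul_mem (n : ℚ)⁻¹ (W.sub_mem (W.add_mem (W.sub_mem (hW ![v 1, v 2, v 3])
      (hW ![v 0, v 2, v 3])) (hW ![v 0, v 1, v 3])) (hW ![v 0, v 1, v 2]))
    rwa [hookPair_boundary, smul_smul, inv_mul_cancel₀ (by exact_mod_cast hn), one_smul,
      ← vec_four] at h
  have h3 : ∀ v : Fin 3 → Fin n, (hookPolytabloid v, 0) ∈ W := by
    intro v
    have h0 : ((0, coneSum v) : ((Fin n → ℕ) →₀ ℚ) × ((Fin n → ℕ) →₀ ℚ)) ∈ W := by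
      have : ((0, coneSum v) : ((Fin n → ℕ) →₀ ℚ) × ((Fin n → ℕ) →₀ ℚ)) =
          LinearMap.inr ℚ _ _ (coneSum v) := rfl
      rw [this, coneSum, map_sum]
      exact W.sum_mem fun l _ => h4 _
    have h := W.sub_mem (hW v) h0
    rwa [hookPair, Prod.mk_sub_mk, sub_zero, sub_self] at h
  have h3' : Submodule.span ℚ (Set.range (hookPolytabloid : (Fin 3 → Fin n) → _)) ≤
      W.comap (LinearMap.inl ℚ _ _) := by
    rw [Submodule.span_le]
    rintro _ ⟨v, rfl⟩
    exact h3 v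
  have h4' : Submodule.span ℚ (Set.range (hookPolytabloid : (Fin 4 → Fin n) → _)) ≤
      W.comap (LinearMap.inr ℚ _ _) := by
    rw [Submodule.span_le]
    rintro _ ⟨v, rfl⟩
    exact h4 v
  rintro ⟨p, q⟩ ⟨hp, hq⟩
  have h := W.add_mem (h3' hp) (h4' hq)
  simpa using h

theorem rowModule_coneSum {n k : ℕ} (π : Perm (Fin n)) (v : Fin (k + 1) → Fin n) :
    rowModule n π (coneSum v) = coneSum (π ∘ v) := by
  rw [coneSum, map_sum, coneSum,
    ← Equiv.sum_comp π (fun l => hookPolytabloid (Matrix.vecCons l (π ∘ v)))]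
  refine Finset.sum_congr rfl fun l _ => ?_
  rw [rowModule_hookPolytabloid]
  congr 1
  funext i
  refine Fin.cases ?_ (fun i => ?_) i <;> simp

/-! ### The decompositions of I²(n) -/

theorem range_subtype_I2_le {n : ℕ} : LinearMap.range (I2Sub n).toSubmodule.subtype ≤
    Submodule.span ℚ (Set.range (YBv : (Fin 3 → Fin n) → Ext n)) := by
  rw [Submodule.range_subtype]
  exact (I2_eq_span n).le

theorem specht_hook_three_eq {n : ℕ} (hn : 3 ≤ n) (l : List ℕ) (hl : l.SortedGE)
    (h : l = [n - 2, 1, 1]) : (specht n (YoungDiagram.ofRowLens l hl)).toSubmodule =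
      Submodule.span ℚ (Set.range (hookPolytabloid : (Fin 3 → Fin n) → _)) := by
  obtain ⟨m, rfl⟩ : ∃ m, n = m + 2 + 1 := ⟨n - 3, by omega⟩
  subst h
  exact specht_hook_eq (k := 2) (m := m) (mem_ofRowLens_hook (k := 2) hl) rfl

theorem specht_hook_four_eq {n : ℕ} (hn : 4 ≤ n) (l : List ℕ) (hl : l.SortedGE)
    (h : l = [n - 3, 1, 1, 1]) : (specht n (YoungDiagram.ofRowLens l hl)).toSubmodule =
      Submodule.span ℚ (Set.range (hookPolytabloid : (Fin 4 → Fin n) → _)) := by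
  obtain ⟨m, rfl⟩ : ∃ m, n = m + 3 + 1 := ⟨n - 4, by omega⟩
  subst h
  exact specht_hook_eq (k := 3) (m := m) (mem_ofRowLens_hook (k := 3) hl) rfl

theorem I2_equiv_hooks (n : ℕ) (hn : 4 ≤ n) :
    Nonempty ((I2Rep n).Equiv
      ((stableV n [1, 1] (sortedGE_one_one hn)).prod
        (stableV n [1, 1, 1] (sortedGE_one_one_one hn)))) := by
  have e3 := specht_hook_three_eq (by omega) _ (sortedGE_one_one hn) rfl
  have e4 := specht_hook_four_eq hn _ (sortedGE_one_one_one hn) rfl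
  have hp : ∀ v : Fin 3 → Fin n, hookPolytabloid v ∈ (specht n _).toSubmodule := fun v =>
    e3.ge (Submodule.subset_span ⟨v, rfl⟩)
  have hq : ∀ v : Fin 3 → Fin n, coneSum v ∈ (specht n _).toSubmodule := fun v =>
    e4.ge (Submodule.sum_mem _ fun l _ => Submodule.subset_span ⟨_, rfl⟩)
  refine Representation.nonempty_equiv_of_span (Γ := Fin 3 → Fin n) (fun π v => π ∘ v)
    (fun v => ⟨YBv v, YBv_mem_I2 v⟩) (fun v => (⟨_, hp v⟩, ⟨_, hq v⟩))
    (fun π v => Subtype.ext (action_YBv π v))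
    (fun π v => Prod.ext (Subtype.ext (rowModule_hookPolytabloid π v))
      (Subtype.ext (rowModule_coneSum π v)))
    (Submodule.subtype _) ((Submodule.subtype _).prodMap (Submodule.subtype _))
    (Submodule.subtype_injective _)
    ((Submodule.subtype_injective _).prodMap (Submodule.subtype_injective _))
    range_subtype_I2_le ?_ (relMap hookPair) (hookPairLift n) (a := 6) (b := 6 * n)
    (by norm_num) (mul_ne_zero (by norm_num) (by norm_cast; omega))
    relMap_hookPair hookPairLift_hookPair
  rintro _ ⟨⟨⟨p, hp⟩, ⟨q, hq⟩⟩, rfl⟩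
  exact prod_le_span_hookPair (by omega) ⟨e3.le hp, e4.le hq⟩

theorem I2_two : I2 2 = ⊥ := by
  rw [eq_bot_iff]
  refine I2_le_span.trans (Submodule.span_le.2 ?_)
  rintro _ ⟨i, j, k, hij, hjk, rfl⟩
  omega

theorem I2_three_equiv : Nonempty ((I2Rep 3).Equiv (V 3 [1, 1, 1] sortedGE_three_ones)) := by
  have e3 := specht_hook_three_eq le_rfl _ sortedGE_three_ones rfl
  have hp : ∀ v : Fin 3 → Fin 3, hookPolytabloid v ∈ (specht 3 _).toSubmodule := fun v =>
    e3.ge (Submodule.subset_span ⟨v, rfl⟩)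
  -- A column of four distinct entries does not fit in `Fin 3`, so the second hook module
  -- disappears.
  have hcone : ∀ v : Fin 3 → Fin 3, coneSum v = 0 := fun v =>
    Finset.sum_eq_zero fun l _ => altSum_eq_zero _ _ fun h => by
      simpa using Fintype.card_le_of_injective _ h
  refine Representation.nonempty_equiv_of_span (Γ := Fin 3 → Fin 3) (fun π v => π ∘ v)
    (fun v => ⟨YBv v, YBv_mem_I2 v⟩) (fun v => ⟨_, hp v⟩)
    (fun π v => Subtype.ext (action_YBv π v))
    (fun π v => Subtype.ext (rowModule_hookPolytabloid π v))
    (Submodule.subtype _) (Submodule.subtype _)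
    (Submodule.subtype_injective _) (Submodule.subtype_injective _)
    range_subtype_I2_le ?_ (LinearMap.fst ℚ _ _ ∘ₗ relMap hookPair)
    (hookPairLift 3 ∘ₗ LinearMap.inl ℚ _ _) (a := 6) (b := 6 * (3 : ℕ))
    (by norm_num) (by norm_num) (fun v => congrArg Prod.fst (relMap_hookPair v)) (fun v => ?_)
  · rw [Submodule.range_subtype]
    exact e3.le
  · have h := hookPairLift_hookPair v
    rwa [hookPair, hcone] at h

end Arnold

end

theorem proposition6p3 :
    (∀ (n : ℕ) (hn : 4 ≤ n),
      Nonempty ((Arnold.I2Rep n).Equiv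
        ((SymRep.stableV n [1, 1] (SymRep.sortedGE_one_one hn)).prod
          (SymRep.stableV n [1, 1, 1] (SymRep.sortedGE_one_one_one hn))))) ∧
    Arnold.I2 2 = ⊥ ∧
    Nonempty ((Arnold.I2Rep 3).Equiv (SymRep.V 3 [1, 1, 1] SymRep.sortedGE_three_ones)) :=
  ⟨Arnold.I2_equiv_hooks, Arnold.I2_two, Arnold.I2_three_equiv⟩
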